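/- **Setting.** Let $\mathcal G$ be a finite simple graph with $N$ nodes, maximum degree $\Delta$, and neighbourhoods $\mathcal N_i$. Given initial values $x^i_0\in\mathbb R$ and a step size $\epsilon\in\mathbb R$, the noiseless averaging iteration is $$x^i_{\ell+1}=x^i_\ell-\epsilon\sum_{j\in\mathcal N_i}(x^i_\ell-x^j_\ell).\qquad(1)$$ In each communication round $t=1,2,\dots$ every node sends $n\ge1$ packets (vectors over $\mathbf F_2$ of a fixed length) to each neighbour. Erasures are asymmetric: each packet on each directed link in each round is erased with probability $p\in[0,1]$, and all these erasures are independent. **Codes.** A causal linear time-invariant code of rate $R=k/n$ ($k\ge1$) maps information blocks $b_1,b_2,\dots$ of $k$ packets to $c_t=G_1b_t+G_2b_{t-1}+\dots+G_tb_1$, blocks of $n$ packets. After round $t$ the decoder outputs, for each $\tau\le t$, the value $\hat b_{\tau|t}=b_\tau$ if the linear equations given by the packets received in rounds $1,\dots,t$ determine $b_\tau$ uniquely, and an erasure otherwise. The code is $(R,\beta)$-anytime reliable if it has rate $R$ and $P(\hat b_{\tau|t}\ne b_\tau)\le2^{-\beta(t-\tau+1)}$ for every information stream and all $1\le\tau\le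 t$, when packets are erased independently with probability $p$. **Protocol.** Every node $i$ uses an $(R,\beta)$-anytime reliable causal linear code. A message is either an iterate $x^i_\ell$ together with its index $\ell$, or a wait symbol; it is written as one information block, and quantization is ignored, i.e. a receiver that decodes the block knows the message. Node $i$ can compute $x^i_{\ell+1}$ after round $t$ if it can compute $x^i_\ell$ and has decoded $x^j_\ell$ from every $j\in\mathcal N_i$ by then; $x^i_0$ is always known to it. In round $t+1$, if $x^i_0,\dots,x^i_{m-1}$ are the iterates that node $i$ has sent in rounds $1,\dots,t$ (so $m=0$ in round $1$), it encodes and sends $x^i_m$ to all its neighbours if it can compute $x^i_m$ after round $t$, and the wait symbol otherwise. **Theorem.** Let $R'\in[0,1]$. For $M\in\mathbb N$ let $P_{M,R'}$ be the probability that the network requires more than $M$ communication rounds to compute $MR'$ iterations of (1), that is, that after $M$ rounds not every node has computed the first $\lceil MR'\rceil$ iterates of (1) correctly. Write $H(q)=-q\log q-(1-q)\log(1-q)$, with all logarithms to base $2$. Then: 1. For every $M$, $$P_{M,R'}\le N\,2^{-M\left((1-R')\frac{\beta}{2}-H(R')-\log(\Delta+1)\right)}.$$ 2. The protocol simulates the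 averaging without erasures: whenever a node computes an $\ell$-th iterate in the protocol, its value is the $x^i_\ell$ of (1). 3. If $(1-R')\frac{\beta}{2}>H(R')+\log(\Delta+1)$, then $P_{M,R'}$ decays exponentially in $M$: there are $c>0$ and $K$ with $P_{M,R'}\le K2^{-cM}$ for all $M$. If moreover $\mathcal G$ is connected, $\epsilon>0$, and $\epsilon\lambda<2$ for every eigenvalue $\lambda$ of the Laplacian of $\mathcal G$, then the protocol achieves average consensus: almost surely, for every node $i$, the latest iterate (with index at most $t$) that $i$ can compute after round $t$ converges to $\frac1N\sum_jx^j_0$ as $t\to\infty$. -/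

import Mathlib

open MeasureTheory ProbabilityTheory Filter Topology
open scoped unitInterval

namespace ErasureConsensus

noncomputable section

/-! ### Causal linear codes over the packet erasure channel -/

/-- A packet: a vector over `F₂` whose bits are indexed by `Λ`. -/
abbrev Packet (Λ : Type*) : Type _ := Λ → ZMod 2

/-- A linear time-invariant causal code with generators `gen 1, gen 2, …` (`gen 0` is never used).
In every round the encoder takes in `k` packets and puts out `n` packets, so its rate is `k / n`. -/
structure CausalCode (n k : ℕ) (Λ : Type*) where
  gen : ℕ → ((Fin k → Packet Λ) →ₗ[ZMod 2] (Fin n → Packet Λ))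

/-- The code block of round `t ≥ 1`: `c_t = G₁ b_t + G₂ b_{t-1} + ⋯ + G_t b₁`. -/
def CausalCode.encode {n k : ℕ} {Λ : Type*} (C : CausalCode n k Λ)
    (b : ℕ → Fin k → Packet Λ) (t : ℕ) : Fin n → Packet Λ :=
  ∑ s ∈ Finset.Icc 1 t, C.gen (t - s + 1) (b s)

/-- The channel output when the blocks `c` are sent and packet `q` of round `t` gets through
exactly if `e t q = true`; `none` is an erasure. -/
def channel {n : ℕ} {Λ : Type*} (e : ℕ → Fin n → Bool) (c : ℕ → Fin n → Packet Λ) :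
    ℕ → Fin n → Option (Packet Λ) :=
  fun t q => if e t q = true then some (c t q) else none

/-- The information stream `b` solves the linear equations given by the packets that were
received in rounds `1, …, t`. -/
def CausalCode.Consistent {n k : ℕ} {Λ : Type*} (C : CausalCode n k Λ)
    (y : ℕ → Fin n → Option (Packet Λ)) (t : ℕ) (b : ℕ → Fin k → Packet Λ) : Prop :=
  ∀ s ∈ Finset.Icc 1 t, ∀ q : Fin n, ∀ z : Packet Λ, y s q = some z → C.encode b s q = z

open Classical in
/-- Maximum likelihood decoding on the erasure channel: the estimate `b̂_{τ|t}` of `b_τ` after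
round `t` is the value of the variable `b_τ` if the received equations determine it uniquely; if
they do not, the variable is left erased (`none`). -/
def CausalCode.decode {n k : ℕ} {Λ : Type*} (C : CausalCode n k Λ)
    (y : ℕ → Fin n → Option (Packet Λ)) (τ t : ℕ) : Option (Fin k → Packet Λ) :=
  if h : ∃! z : Fin k → Packet Λ, ∃ b, C.Consistent y t b ∧ b τ = z then some h.choose else none

/-- The law of the erasures on one link: all packets of all rounds are erased independently with
probability `p` (`false` means erased). -/
def erasureLaw (n : ℕ) (p : I) : Measure (ℕ × Fin n → Bool) :=
  Measure.infinitePi fun _ => bernoulliMeasure false true p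

/-- `(R, β)`-anytime reliability with `d₀ = 0` over the packet erasure channel with erasure
probability `p`: the code has rate `R`, and `P(b̂_{τ|t} ≠ b_τ) ≤ 2^{-β(t-τ+1)}` for every
information stream `b` and all `1 ≤ τ ≤ t`. -/
def CausalCode.IsAnytimeReliable {n k : ℕ} {Λ : Type*} (C : CausalCode n k Λ) (p : I)
    (R β : ℝ) : Prop :=
  (k : ℝ) / n = R ∧
  ∀ (b : ℕ → Fin k → Packet Λ) (τ t : ℕ), 1 ≤ τ → τ ≤ t →
    (erasureLaw n p).real
        {e | C.decode (channel (fun s q => e (s, q)) (C.encode b)) τ t ≠ some (b τ)}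
      ≤ (2 : ℝ) ^ (-β * ((t : ℝ) - τ + 1))

/-! ### The network -/

/-- The averaging iteration without erasures,
`x^i_{ℓ+1} = x^i_ℓ - ε ∑_j a_{ij} (x^i_ℓ - x^j_ℓ)`. -/
def noiseless {ι : Type*} [Fintype ι] (G : SimpleGraph ι) [DecidableRel G.Adj] (ε : ℝ)
    (x₀ : ι → ℝ) : ℕ → ι → ℝ
  | 0 => x₀
  | ℓ + 1 => fun i => noiseless G ε x₀ ℓ i
      - ε * ∑ j ∈ G.neighborFinset i, (noiseless G ε x₀ ℓ i - noiseless G ε x₀ ℓ j)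

/-- Asymmetric erasures: `X i j t q` tells whether packet `q` of round `t` from node `j` to node
`i` is received. Every packet on every directed link in every round is erased with probability
`p`, and all these erasures are independent. -/
structure IsAsymmetricErasure {ι Ω : Type*} [MeasurableSpace Ω] (G : SimpleGraph ι) {n : ℕ}
    (p : I) (μ : Measure Ω) (X : ι → ι → ℕ → Fin n → Ω → Bool) : Prop where
  measurable : ∀ i j t q, G.Adj i j → Measurable (X i j t q)
  law : ∀ i j t q, G.Adj i j → μ.map (X i j t q) = bernoulliMeasure false true p
  indep : iIndepFun
    (fun (a : {l : ι × ι // G.Adj l.1 l.2} × ℕ × Fin n) =>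
      X a.1.1.1 a.1.1.2 a.2.1 a.2.2) μ

/-! ### The protocol -/

/-- What a node has to tell its neighbours in one round: `none` is the wait symbol `w`, and
`some (ℓ, x)` is its `ℓ`-th iterate, of value `x`. -/
abbrev Message : Type := Option (ℕ × ℝ)

/-- The data of the protocol: the code of each node, the way messages are written as `k` packets,
the step size, and the initial values. -/
structure Protocol (ι : Type*) (n k : ℕ) (Λ : Type*) where
  code : ι → CausalCode n k Λ
  pack : Message → Fin k → Packet Λ
  ε : ℝ
  x₀ : ι → ℝ

open Classical in
/-- The entry for round `τ` of the output queue of a link after round `t`, when the sender's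
messages are `b` and the receptions on the link are `e`. A message whose packets are decoded is
known to the receiver (quantization is ignored, so `pack` may be any map); otherwise the entry is
erased (`none`). -/
def outputQueue {n k : ℕ} {Λ : Type*} (C : CausalCode n k Λ) (pack : Message → Fin k → Packet Λ)
    (b : ℕ → Message) (e : ℕ → Fin n → Bool) (τ t : ℕ) : Option Message :=
  if C.decode (channel e (C.encode fun s => pack (b s))) τ t = some (pack (b τ))
  then some (b τ) else none

/-- The iterates `(ℓ, x)` contained in the output queue of a link after round `t`. -/
def heard {n k : ℕ} {Λ : Type*} (C : CausalCode n k Λ) (pack : Message → Fin k → Packet Λ)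
    (b : ℕ → Message) (e : ℕ → Fin n → Bool) (t : ℕ) : Set (ℕ × ℝ) :=
  {a | ∃ τ ∈ Finset.Icc 1 t, outputQueue C pack b e τ t = some (some a)}

open Classical in
/-- The `ℓ`-th iterate of a node with neighbours `nbrs` and initial value `x`, computed from the
iterates `Q j` it has heard from each neighbour `j`; `none` if it cannot be computed from them. -/
def localIterate {ι : Type*} (nbrs : Finset ι) (ε x : ℝ) (Q : ι → Set (ℕ × ℝ)) : ℕ → Option ℝ
  | 0 => some x
  | ℓ + 1 =>
    if h : ∃ z : ι → ℝ, ∀ j ∈ nbrs, (ℓ, z j) ∈ Q j then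
      (localIterate nbrs ε x Q ℓ).map fun y => y - ε * ∑ j ∈ nbrs, (y - h.choose j)
    else none

/-- The `ℓ`-th iterate that node `i` can compute after round `t`, when `b j s` is the message of
node `j` in round `s` and `e i j` are the receptions on the link from `j` to `i`. -/
def iterateOf {ι : Type*} [Fintype ι] (G : SimpleGraph ι) [DecidableRel G.Adj] {n k : ℕ}
    {Λ : Type*} (S : Protocol ι n k Λ) (e : ι → ι → ℕ → Fin n → Bool) (b : ι → ℕ → Message)
    (i : ι) (t ℓ : ℕ) : Option ℝ :=
  localIterate (G.neighborFinset i) S.ε (S.x₀ i)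
    (fun j => heard (S.code j) S.pack (b j) (e i j) t) ℓ

/-- How many iterates a node has sent in rounds `1, …, t`. -/
def numSent (b : ℕ → Message) (t : ℕ) : ℕ :=
  ((Finset.Icc 1 t).filter fun s => (b s).isSome).card

/-- The messages `history t i s` that the nodes `i` have sent in rounds `s = 1, …, t`. In round
`t + 1`, node `i`, having sent its iterates `0, …, m - 1` so far, sends its iterate `m` to all its
neighbours if it can compute it from what it has decoded after round `t`, and waits otherwise. -/
def history {ι : Type*} [Fintype ι] (G : SimpleGraph ι) [DecidableRel G.Adj] {n k : ℕ}
    {Λ : Type*} (S : Protocol ι n k Λ) (e : ι → ι → ℕ → Fin n → Bool) : ℕ → ι → ℕ → Message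
  | 0 => fun _ _ => none
  | t + 1 => fun i s =>
      if s = t + 1 then
        (iterateOf G S e (history G S e t) i t (numSent (history G S e t i) t)).map fun x =>
          (numSent (history G S e t i) t, x)
      else history G S e t i s

/-- The value that node `i` has for its `ℓ`-th iterate after `t` rounds of the protocol; `none` if
it is not able to compute that iterate yet. -/
def computed {ι : Type*} [Fintype ι] (G : SimpleGraph ι) [DecidableRel G.Adj] {n k : ℕ}
    {Λ : Type*} (S : Protocol ι n k Λ) (e : ι → ι → ℕ → Fin n → Bool) (i : ι) (t ℓ : ℕ) :
    Option ℝ :=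
  iterateOf G S e (history G S e t) i t ℓ

/-- After `M` rounds all nodes have successfully computed `m` iterations of the averaging without
erasures. -/
def Completes {ι : Type*} [Fintype ι] (G : SimpleGraph ι) [DecidableRel G.Adj] {n k : ℕ}
    {Λ : Type*} (S : Protocol ι n k Λ) (e : ι → ι → ℕ → Fin n → Bool) (M m : ℕ) : Prop :=
  ∀ i, ∀ ℓ ≤ m, computed G S e i M ℓ = some (noiseless G S.ε S.x₀ ℓ i)

/-- The probability that more than `M` rounds are required for `M R'` iterations, that is, for
`⌈M R'⌉` of them. -/
def failureProb {ι Ω : Type*} [Fintype ι] [MeasurableSpace Ω] (G : SimpleGraph ι)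
    [DecidableRel G.Adj] {n k : ℕ} {Λ : Type*} (S : Protocol ι n k Λ) (μ : Measure Ω)
    (X : ι → ι → ℕ → Fin n → Ω → Bool) (M : ℕ) (R' : ℝ) : ℝ :=
  μ.real {ω | ¬ Completes G S (fun i j t q => X i j t q ω) M ⌈(M : ℝ) * R'⌉₊}

open Classical in
/-- The value node `i` holds after `t` rounds: the latest iterate, up to the `t`-th, that it has
been able to compute. -/
def currentValue {ι : Type*} [Fintype ι] (G : SimpleGraph ι) [DecidableRel G.Adj] {n k : ℕ}
    {Λ : Type*} (S : Protocol ι n k Λ) (e : ι → ι → ℕ → Fin n → Bool) (i : ι) (t : ℕ) : ℝ :=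
  (computed G S e i t (Nat.findGreatest (fun ℓ => (computed G S e i t ℓ).isSome) t)).getD (S.x₀ i)

/-- Binary entropy in bits. -/
def entropy (q : ℝ) : ℝ := Real.binEntropy q / Real.log 2

end

end ErasureConsensus

/-! The erasure decoder never returns a wrong block, so everything a node hears was really sent, and
induction on the rounds shows that lossy links only delay the averaging (`computed_eq_noiseless`).
It remains to bound the delay.

By linearity, whether a block is decoded depends on the erasures alone, not on the messages,
although these are themselves random. A failure after round `t` yields an error span: rounds `r + 1,
…, t` whose erasures hide a difference of streams starting in round `r + 1`. It involves only these
rounds and, by anytime reliability, has probability at most `y ^ (t - r)`, where `y = 2 ^ (-β)`.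

If a node waits, some neighbour is late itself or has sent the missing iterate inside an error span.
Following the cause backwards gives a chain (`Stall`) that reaches round 0 in few steps, each with
at most `D = Δ + 1` choices of node. The spans of a chain occupy disjoint rounds and are
independent, so a union bound gives a recursion in the number of steps
(`measureReal_stall_succ_le`). It is solved by `D * A ^ ℓ * w ^ t` with `A * (w - y) = D`
(`measureReal_stall_le`).

The choice `w = y / (1 - R')` is a Chernoff bound and produces the entropy term
(`chernoff_estimate`). For a fixed number of iterations any `w` between `y` and `1` makes the
failure probabilities summable, so by Borel–Cantelli every iterate is eventually computed; consensus
then follows from the spectrum of the Laplacian. -/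

namespace ErasureConsensus

/-! ### Decoding failures of a linear code -/

namespace CausalCode

variable {n k : ℕ} {Λ : Type*} (C : CausalCode n k Λ)

theorem encode_sub (b b' : ℕ → Fin k → Packet Λ) (t : ℕ) :
    C.encode (b - b') t = C.encode b t - C.encode b' t := by
  simp [encode, Finset.sum_sub_distrib]

/-- The difference of two information streams that explain the same receptions. -/
def Invisible (e : ℕ → Fin n → Bool) (t : ℕ) (d : ℕ → Fin k → Packet Λ) : Prop :=
  ∀ s ∈ Finset.Icc 1 t, ∀ q, e s q = true → C.encode d s q = 0

theorem consistent_channel_iff (e : ℕ → Fin n → Bool) (b b' : ℕ → Fin k → Packet Λ) (t : ℕ) :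
    C.Consistent (channel e (C.encode b)) t b' ↔ C.Invisible e t (b' - b) := by
  unfold Consistent Invisible channel
  refine forall₂_congr fun s _ => forall_congr' fun q => ?_
  rw [encode_sub]
  by_cases h : e s q = true
  · simp [h, sub_eq_zero, eq_comm]
  · simp [h]

/-- The solutions of the received equations form a coset of the invisible streams. The criterion
does not mention `b`, so reliability for one fixed stream controls the adaptive messages of the
protocol. -/
theorem decode_channel_eq_some_iff (e : ℕ → Fin n → Bool) (b : ℕ → Fin k → Packet Λ) (τ t : ℕ) :
    C.decode (channel e (C.encode b)) τ t = some (b τ) ↔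
      ∀ d, C.Invisible e t d → d τ = 0 := by
  have hb : C.Consistent (channel e (C.encode b)) t b := by
    rw [consistent_channel_iff, sub_self]
    intro s _ q _
    simp [encode]
  unfold decode
  constructor
  · intro h d hd
    split_ifs at h with hu
    have h1 := hu.unique ⟨b, hb, rfl⟩
      ⟨b + d, by rw [consistent_channel_iff, add_sub_cancel_left]; exact hd, rfl⟩
    simpa using h1
  · intro h
    have hu : ∃! z : Fin k → Packet Λ, ∃ b',
        C.Consistent (channel e (C.encode b)) t b' ∧ b' τ = z := by
      refine ⟨b τ, ⟨b, hb, rfl⟩, ?_⟩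
      rintro z ⟨b', hb', rfl⟩
      rw [consistent_channel_iff] at hb'
      exact sub_eq_zero.1 (h _ hb')
    rw [dif_pos hu]
    obtain ⟨b', hb', h2⟩ := hu.choose_spec.1
    rw [consistent_channel_iff] at hb'
    rw [← h2, ← sub_eq_zero.1 (h _ hb')]

/-- Two streams that first differ in round `r + 1` cannot be told apart by what is received in
rounds `r + 1, …, t`. -/
def ErrorSpan (e : ℕ → Fin n → Bool) (r t : ℕ) : Prop :=
  ∃ d : ℕ → Fin k → Packet Λ, (∀ s ∈ Finset.Icc 1 r, d s = 0) ∧ d (r + 1) ≠ 0 ∧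
    ∀ s ∈ Finset.Ioc r t, ∀ q, e s q = true → C.encode d s q = 0

theorem errorSpan_congr {e e' : ℕ → Fin n → Bool} {r t : ℕ}
    (h : ∀ s ∈ Finset.Ioc r t, e s = e' s) : C.ErrorSpan e r t ↔ C.ErrorSpan e' r t := by
  unfold ErrorSpan
  refine exists_congr fun d => and_congr_right fun _ => and_congr_right fun _ => ?_
  exact forall₂_congr fun s hs => by rw [h s hs]

/-- Take an invisible difference that is nonzero at `τ`; the span starts at its first nonzero block.
-/
theorem exists_errorSpan_of_decode_ne {e : ℕ → Fin n → Bool} {b : ℕ → Fin k → Packet Λ} {τ t : ℕ}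
    (hτ : 1 ≤ τ) (h : C.decode (channel e (C.encode b)) τ t ≠ some (b τ)) :
    ∃ r < τ, C.ErrorSpan e r t := by
  classical
  rw [Ne, decode_channel_eq_some_iff] at h
  push Not at h
  obtain ⟨d, hd, hne⟩ := h
  have hex : ∃ s, d (s + 1) ≠ 0 := ⟨τ - 1, by rwa [Nat.sub_add_cancel hτ]⟩
  refine ⟨Nat.find hex, ?_, d, ?_, Nat.find_spec hex, ?_⟩
  · have := Nat.find_min' hex (m := τ - 1) (by rwa [Nat.sub_add_cancel hτ])
    omega
  · intro s hs
    rw [Finset.mem_Icc] at hs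
    have := Nat.find_min hex (m := s - 1) (by omega)
    rw [Nat.sub_add_cancel hs.1] at this
    exact not_not.1 this
  · intro s hs
    rw [Finset.mem_Ioc] at hs
    exact hd s (Finset.mem_Icc.2 (by omega))

/-- By causality a difference vanishing up to round `r` is encoded as zero there, so receptions in
those rounds cannot reveal it. -/
theorem decode_ne_of_errorSpan {e : ℕ → Fin n → Bool} (b : ℕ → Fin k → Packet Λ) {r t : ℕ}
    (h : C.ErrorSpan e r t) :
    C.decode (channel e (C.encode b)) (r + 1) t ≠ some (b (r + 1)) := by
  rw [Ne, decode_channel_eq_some_iff]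
  obtain ⟨d, h0, hr, hd⟩ := h
  push Not
  refine ⟨d, fun s hs q hq => ?_, hr⟩
  rw [Finset.mem_Icc] at hs
  rcases le_or_gt s r with hsr | hsr
  · have : C.encode d s = 0 := by
      refine Finset.sum_eq_zero fun u hu => ?_
      rw [Finset.mem_Icc] at hu
      rw [h0 u (Finset.mem_Icc.2 (by omega)), map_zero]
    simp [this]
  · exact hd s (Finset.mem_Ioc.2 ⟨hsr, hs.2⟩) q hq

end CausalCode

/-! ### The messages of the protocol -/

theorem localIterate_eq {ι : Type*} (nbrs : Finset ι) (ε : ℝ) (Q : ι → Set (ℕ × ℝ)) (i : ι)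
    (y : ℕ → ι → ℝ) (hy : ∀ ℓ, y (ℓ + 1) i = y ℓ i - ε * ∑ j ∈ nbrs, (y ℓ i - y ℓ j))
    (hQ : ∀ j ∈ nbrs, ∀ a ∈ Q j, a.2 = y a.1 j) (ℓ : ℕ) (x : ℝ)
    (h : localIterate nbrs ε (y 0 i) Q ℓ = some x) : x = y ℓ i := by
  induction ℓ generalizing x with
  | zero => simpa [localIterate, eq_comm] using h
  | succ ℓ ih =>
    rw [localIterate] at h
    split_ifs at h with hz
    obtain ⟨v, hv, rfl⟩ := Option.map_eq_some_iff.1 h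
    rw [hy, ih v hv]
    congr 2
    refine Finset.sum_congr rfl fun j hj => ?_
    rw [show hz.choose j = y ℓ j from hQ j hj _ (hz.choose_spec j hj)]

theorem exists_not_heard_of_localIterate_eq_none {ι : Type*} {nbrs : Finset ι} {ε x : ℝ}
    {Q : ι → Set (ℕ × ℝ)} {ℓ : ℕ} (h : localIterate nbrs ε x Q ℓ = none) :
    ∃ m < ℓ, ∃ j ∈ nbrs, ∀ z, (m, z) ∉ Q j := by
  induction ℓ with
  | zero => simp [localIterate] at h
  | succ ℓ ih =>
    rw [localIterate] at h
    split_ifs at h with hz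
    · obtain ⟨m, hm, hj⟩ := ih (Option.map_eq_none_iff.1 h)
      exact ⟨m, by omega, hj⟩
    · refine ⟨ℓ, by omega, ?_⟩
      by_contra hcon
      push Not at hcon
      choose! z hz' using hcon
      exact hz ⟨z, hz'⟩

section Stall

variable {ι : Type*} (G : SimpleGraph ι) {n k : ℕ} {Λ : Type*} (S : Protocol ι n k Λ)
  (e : ι → ι → ℕ → Fin n → Bool)

/-- A chain of waiting that leads from node `j` in round `t` back to the start in at most `ℓ` steps:
each step goes to a neighbour or stays, and goes back one round and the length of an error span on
the link it follows. -/
def Stall : ℕ → ι → ℕ → Prop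
  | 0, _, t => t = 0
  | ℓ + 1, j, t => t = 0 ∨ ∃ u, t = u + 1 ∧
      ((∃ i, (i = j ∨ G.Adj j i) ∧ Stall ℓ i u) ∨
        ∃ i, G.Adj j i ∧ ∃ r < u, (S.code i).ErrorSpan (e j i) r u ∧ Stall ℓ i r)

theorem stall_zero_right (ℓ : ℕ) (j : ι) : Stall G S e ℓ j 0 := by
  cases ℓ <;> simp [Stall]

theorem stall_succ_succ (ℓ u : ℕ) (j : ι) : Stall G S e (ℓ + 1) j (u + 1) ↔
    (∃ i, (i = j ∨ G.Adj j i) ∧ Stall G S e ℓ i u) ∨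
      ∃ i, G.Adj j i ∧ ∃ r < u, (S.code i).ErrorSpan (e j i) r u ∧ Stall G S e ℓ i r := by
  simp [Stall]

end Stall

/-! ### Correctness of the computed values, and delays as stalls -/

section History

variable {ι : Type*} [Fintype ι] (G : SimpleGraph ι) [DecidableRel G.Adj] {n k : ℕ}
  {Λ : Type*} (S : Protocol ι n k Λ) (e : ι → ι → ℕ → Fin n → Bool)

theorem history_succ (t : ℕ) (i : ι) (s : ℕ) :
    history G S e (t + 1) i s = if s = t + 1 then
      (computed G S e i t (numSent (history G S e t i) t)).map fun x =>
        (numSent (history G S e t i) t, x)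
      else history G S e t i s := rfl

theorem history_eq_of_le {s t : ℕ} (hst : s ≤ t) (i : ι) :
    history G S e t i s = history G S e s i s := by
  induction t, hst using Nat.le_induction with
  | base => rfl
  | succ t hst ih => rw [history_succ, if_neg (by omega), ih]

theorem numSent_congr {b b' : ℕ → Message} {t : ℕ} (h : ∀ s ≤ t, b s = b' s) :
    numSent b t = numSent b' t := by
  unfold numSent
  congr 1
  refine Finset.filter_congr fun s hs => ?_
  rw [h s (Finset.mem_Icc.1 hs).2]

theorem numSent_mono (b : ℕ → Message) : Monotone (numSent b) := fun _ _ h =>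
  Finset.card_le_card (Finset.filter_subset_filter _ (Finset.Icc_subset_Icc_right h))

theorem numSent_succ (b : ℕ → Message) (t : ℕ) :
    numSent b (t + 1) = numSent b t + if (b (t + 1)).isSome then 1 else 0 := by
  unfold numSent
  rw [← Finset.insert_Icc_right_eq_Icc_add_one (by omega), Finset.filter_insert]
  split_ifs with h
  · rw [Finset.card_insert_of_notMem (by simp)]
  · rfl

/-- The message that node `i` sends in round `t`. -/
noncomputable def sent (i : ι) (t : ℕ) : Message := history G S e t i t

theorem numSent_history {s t : ℕ} (hst : s ≤ t) (i : ι) :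
    numSent (history G S e t i) s = numSent (sent G S e i) s :=
  numSent_congr fun _ hu => history_eq_of_le G S e (hu.trans hst) i

theorem sent_succ (i : ι) (t : ℕ) :
    sent G S e i (t + 1) = (computed G S e i t (numSent (sent G S e i) t)).map fun x =>
      (numSent (sent G S e i) t, x) := by
  rw [sent, history_succ, if_pos rfl, numSent_history G S e le_rfl]

theorem mem_heard {C : CausalCode n k Λ} {pack : Message → Fin k → Packet Λ} {b : ℕ → Message}
    {e : ℕ → Fin n → Bool} {t : ℕ} {a : ℕ × ℝ} (h : a ∈ heard C pack b e t) :
    ∃ τ ≤ t, b τ = some a := by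
  obtain ⟨τ, hτ, h⟩ := h
  unfold outputQueue at h
  split_ifs at h
  exact ⟨τ, (Finset.mem_Icc.1 hτ).2, Option.some.inj h⟩

theorem sent_zero (i : ι) : sent G S e i 0 = none := rfl

/-- Only pairs that were actually sent enter an output queue, so correctness passes from the
messages to the iterates computed from them. -/
theorem computed_eq_noiseless_of_sent {t : ℕ}
    (h : ∀ s ≤ t, ∀ j a, sent G S e j s = some a → a.2 = noiseless G S.ε S.x₀ a.1 j)
    (i : ι) (ℓ : ℕ) (x : ℝ) (hx : computed G S e i t ℓ = some x) :
    x = noiseless G S.ε S.x₀ ℓ i := by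
  refine localIterate_eq _ S.ε _ i (noiseless G S.ε S.x₀) (fun _ => rfl) ?_ ℓ x hx
  intro j _ a ha
  obtain ⟨τ, hτ, h'⟩ := mem_heard ha
  rw [history_eq_of_le G S e hτ] at h'
  exact h τ hτ j a h'

theorem sent_eq_noiseless (t : ℕ) : ∀ s ≤ t, ∀ j a, sent G S e j s = some a →
    a.2 = noiseless G S.ε S.x₀ a.1 j := by
  induction t with
  | zero =>
    intro s hs j a h
    rw [Nat.le_zero.1 hs, sent_zero] at h
    cases h
  | succ t ih =>
    intro s hs j a h
    rcases hs.lt_or_eq with hs | rfl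
    · exact ih s (by omega) j a h
    · rw [sent_succ] at h
      obtain ⟨x, hx, rfl⟩ := Option.map_eq_some_iff.1 h
      exact computed_eq_noiseless_of_sent G S e ih j _ x hx

theorem computed_eq_noiseless {i : ι} {t ℓ : ℕ} {x : ℝ} (hx : computed G S e i t ℓ = some x) :
    x = noiseless G S.ε S.x₀ ℓ i :=
  computed_eq_noiseless_of_sent G S e (sent_eq_noiseless G S e t) i ℓ x hx

theorem exists_sent_of_lt_numSent {i : ι} {t m : ℕ} (h : m < numSent (sent G S e i) t) :
    ∃ τ < t, numSent (sent G S e i) τ = m ∧ ∃ x, sent G S e i (τ + 1) = some (m, x) := by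
  induction t with
  | zero => simp [numSent] at h
  | succ t ih =>
    rcases lt_or_ge m (numSent (sent G S e i) t) with hm | hm
    · obtain ⟨τ, hτ, h'⟩ := ih hm
      exact ⟨τ, by omega, h'⟩
    · rw [numSent_succ] at h
      split_ifs at h with hs
      · have heq : numSent (sent G S e i) t = m := by omega
        refine ⟨t, by omega, heq, ?_⟩
        obtain ⟨a, ha⟩ := Option.isSome_iff_exists.1 hs
        have ha' := ha
        rw [sent_succ] at ha'
        obtain ⟨x, _, rfl⟩ := Option.map_eq_some_iff.1 ha'
        exact ⟨x, by rw [ha, heq]⟩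
      · omega

/-- Some iterate `m < ℓ` of a neighbour `i` is missing. Either `i` has not sent it, or its block is
not decoded, which yields an error span. -/
theorem exists_of_computed_eq_none {j : ι} {t ℓ : ℕ} (h : computed G S e j t ℓ = none) :
    ∃ m < ℓ, ∃ i, G.Adj j i ∧ (numSent (sent G S e i) t ≤ m ∨
      ∃ r < t, (S.code i).ErrorSpan (e j i) r t ∧ numSent (sent G S e i) r ≤ m) := by
  obtain ⟨m, hm, i, hi, hz⟩ := exists_not_heard_of_localIterate_eq_none h
  refine ⟨m, hm, i, by simpa using hi, or_iff_not_imp_left.2 fun hlt => ?_⟩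
  obtain ⟨τ, hτ, hnum, x, hx⟩ := exists_sent_of_lt_numSent G S e (not_le.1 hlt)
  have hdec : (S.code i).decode (channel (e j i)
      ((S.code i).encode fun s => S.pack (history G S e t i s))) (τ + 1) t
      ≠ some ((fun s => S.pack (history G S e t i s)) (τ + 1)) := by
    intro hd
    refine hz x ⟨τ + 1, Finset.mem_Icc.2 (by omega), ?_⟩
    rw [outputQueue, if_pos hd, history_eq_of_le G S e (by omega)]
    exact congrArg some hx
  obtain ⟨r, hr, hspan⟩ :=
    (S.code i).exists_errorSpan_of_decode_ne (by omega) hdec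
  -- The span starts no later than the transmission in round `τ + 1`, so at time `r` iterate `m` was
  -- still unsent.
  exact ⟨r, by omega, hspan, (numSent_mono _ (by omega : r ≤ τ)).trans hnum.le⟩

/-- Each step back lowers the bound on the number of sent iterates by one: a node that sent in the
last round had sent one fewer before it, and a node that waited points to a neighbour that was
behind. -/
theorem stall_of_numSent_le {ℓ : ℕ} {j : ι} {t : ℕ} (h : numSent (sent G S e j) t ≤ ℓ) :
    Stall G S e ℓ j t := by
  induction ℓ generalizing j t with
  | zero =>
    rcases t with _ | t
    · rfl
    -- The initial value needs no reception, so every node sends in round 1.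
    · have h1 := numSent_mono (sent G S e j) (by omega : 1 ≤ t + 1)
      have h2 := numSent_succ (sent G S e j) 0
      rw [sent_succ, show numSent (sent G S e j) 0 = 0 by simp [numSent],
        if_pos (by simp [computed, iterateOf, localIterate])] at h2
      rw [Nat.zero_add] at h2
      exact absurd h (by omega)
  | succ ℓ ih =>
    rcases t with _ | t
    · exact stall_zero_right G S e _ _
    rw [stall_succ_succ]
    rw [numSent_succ] at h
    split_ifs at h with hs
    · exact Or.inl ⟨j, Or.inl rfl, ih (by omega)⟩
    · rw [sent_succ, Option.isSome_map, Option.not_isSome_iff_eq_none] at hs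
      obtain ⟨m, hm, i, hi, h' | ⟨r, hr, hspan, h'⟩⟩ := exists_of_computed_eq_none G S e hs
      · exact Or.inl ⟨i, Or.inr hi, ih (by omega)⟩
      · exact Or.inr ⟨i, hi, r, hr, hspan, ih (by omega)⟩

/-- An iterate missing after round `t` has the same causes as a wait in round `t + 1`; hence the
shift in time. -/
theorem stall_of_computed_eq_none {i : ι} {t m ℓ : ℕ} (hℓ : ℓ ≤ m + 1)
    (h : computed G S e i t ℓ = none) : Stall G S e (m + 1) i (t + 1) := by
  rw [stall_succ_succ]
  obtain ⟨m', hm, j, hj, h' | ⟨r, hr, hspan, h'⟩⟩ := exists_of_computed_eq_none G S e h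
  · exact Or.inl ⟨j, Or.inr hj, stall_of_numSent_le G S e (by omega)⟩
  · exact Or.inr ⟨j, hj, r, hr, hspan, stall_of_numSent_le G S e (by omega)⟩

theorem computed_zero (i : ι) (t : ℕ) : computed G S e i t 0 = some (S.x₀ i) := rfl

theorem completes_zero (M : ℕ) : Completes G S e M 0 := by
  intro i ℓ hℓ
  rw [Nat.le_zero.1 hℓ]
  rfl

theorem exists_stall_of_not_completes {M m : ℕ} (h : ¬ Completes G S e M (m + 1)) :
    ∃ i, Stall G S e (m + 1) i (M + 1) := by
  unfold Completes at h
  push Not at h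
  obtain ⟨i, ℓ, hℓ, hne⟩ := h
  refine ⟨i, stall_of_computed_eq_none G S e hℓ ?_⟩
  rw [Option.eq_none_iff_forall_ne_some]
  intro x hx
  exact hne (by rw [hx, ← computed_eq_noiseless G S e hx])

end History

/-! ### Numerical estimates -/

/-- A recursive estimate for the probability of a stall. -/
theorem sum_pow_mul_le {y w D A : ℝ} (hy : 0 ≤ y) (hA : 1 ≤ A)
    (hAD : A * (w - y) = D) {f : ℕ → ℝ} {ℓ : ℕ} (h0 : f 0 ≤ 1)
    (hf : ∀ t, f (t + 1) ≤ D * A ^ ℓ * w ^ t) (t : ℕ) :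
    ∑ r ∈ Finset.range (t + 1), y ^ (t - r) * f r ≤ A ^ (ℓ + 1) * w ^ t := by
  rw [Finset.sum_range_succ']
  have hgeom := (Commute.all w y).geom_sum₂_mul t
  calc _ ≤ ∑ r ∈ Finset.range t, D * A ^ ℓ * (w ^ r * y ^ (t - 1 - r)) + y ^ t := by
        refine add_le_add (Finset.sum_le_sum fun r _ => ?_) ?_
        · rw [show t - (r + 1) = t - 1 - r by omega]
          calc _ ≤ y ^ (t - 1 - r) * (D * A ^ ℓ * w ^ r) := by gcongr; exact hf r
            _ = _ := by ring
        · rw [Nat.sub_zero]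
          exact mul_le_of_le_one_right (by positivity) h0
    -- The factor `D = A * (w - y)` cancels the denominator of the geometric sum. The remaining `y ^
    -- t`, from `r = 0`, is absorbed because `A ^ (ℓ + 1) ≥ 1`.
    _ = A ^ (ℓ + 1) * (w ^ t - y ^ t) + y ^ t := by
        rw [← Finset.mul_sum, ← hgeom, ← hAD]
        ring
    _ ≤ A ^ (ℓ + 1) * w ^ t := by
        nlinarith [one_le_pow₀ hA (n := ℓ + 1), pow_nonneg hy t]

theorem entropy_nonneg {q : ℝ} (h0 : 0 ≤ q) (h1 : q ≤ 1) : 0 ≤ entropy q :=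
  div_nonneg (Real.binEntropy_nonneg h0 h1) (Real.log_nonneg one_le_two)

theorem two_rpow_entropy {q : ℝ} (h0 : 0 < q) (h1 : q < 1) :
    (2 : ℝ) ^ entropy q = q ^ (-q) * (1 - q) ^ (-(1 - q)) := by
  have h1' : 0 < 1 - q := by linarith
  have h2 : Real.log 2 ≠ 0 := (Real.log_pos one_lt_two).ne'
  rw [Real.rpow_def_of_pos two_pos, Real.rpow_def_of_pos h0, Real.rpow_def_of_pos h1',
    ← Real.exp_add, entropy, Real.binEntropy, Real.log_inv, Real.log_inv]
  congr 1
  field_simp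

/-- The value `w = y / (1 - q)` makes `w - y = q * w`, so `A ^ m * w ^ M` becomes `D ^ m * q⁻¹ ^ m *
w ^ (M - m)`. Giving up half of the exponent `β` pays for the denominator: `w ≤ √y`. -/
theorem chernoff_estimate {q β D y : ℝ} (hq0 : 0 < q) (hq1 : q < 1) (hD : 1 ≤ D)
    (hy : y = 2 ^ (-β)) (h : entropy q + Real.logb 2 D < (1 - q) * (β / 2)) :
    y < y / (1 - q) ∧ y / (1 - q) ≤ 1 ∧ ∀ M m : ℕ, ((m + 1 : ℕ) : ℝ) < M * q + 1 →
      D * (D / (y / (1 - q) - y)) ^ m * (y / (1 - q)) ^ M ≤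
        2 ^ (-(M : ℝ) * ((1 - q) * (β / 2) - entropy q - Real.logb 2 D)) := by
  have hq : 0 < 1 - q := by linarith
  have hD0 : 0 < D := by linarith
  set x : ℝ := 2 ^ (-(β / 2)) with hx
  have hx0 : 0 < x := by positivity
  have hyx : y = x ^ 2 := by
    rw [hy, hx, ← Real.rpow_natCast, ← Real.rpow_mul two_pos.le]
    congr 1
    push_cast
    ring
  -- Here the hypothesis on `β` enters: it forces `x ^ (1 - q) ≤ 2 ^ (-entropy q) ≤ (1 - q) ^ (1 -
  -- q)`.
  have hx1 : x ≤ 1 - q := by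
    have h1 : x ^ (1 - q) ≤ (1 - q) ^ (1 - q) := by
      calc x ^ (1 - q) = 2 ^ (-((1 - q) * (β / 2))) := by
            rw [hx, ← Real.rpow_mul two_pos.le]
            congr 1
            ring
        _ ≤ 2 ^ (-entropy q) := by
            apply Real.rpow_le_rpow_of_exponent_le one_le_two
            linarith [Real.logb_nonneg one_lt_two hD]
        _ = q ^ q * (1 - q) ^ (1 - q) := by
            rw [Real.rpow_neg two_pos.le, two_rpow_entropy hq0 hq1, mul_inv,
              Real.rpow_neg hq0.le, Real.rpow_neg hq.le, inv_inv, inv_inv]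
        _ ≤ 1 * (1 - q) ^ (1 - q) := by
            gcongr
            exact Real.rpow_le_one hq0.le hq1.le hq0.le
        _ = _ := one_mul _
    exact (Real.rpow_le_rpow_iff hx0.le hq.le hq).1 h1
  have hw : y / (1 - q) ≤ x := by
    rw [div_le_iff₀ hq, hyx]
    nlinarith
  have hy0 : 0 < y := by rw [hyx]; positivity
  refine ⟨?_, ?_, ?_⟩
  · rw [lt_div_iff₀ hq]
    nlinarith
  · linarith
  intro M m hm
  push_cast at hm
  have hmM : m + 1 ≤ M := by
    have : (m : ℝ) < M := by nlinarith [(Nat.cast_nonneg M : (0 : ℝ) ≤ M)]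
    exact_mod_cast this
  obtain ⟨d, rfl⟩ := Nat.exists_eq_add_of_le (show m ≤ M by omega)
  have hA : D / (y / (1 - q) - y) = D * q⁻¹ * (y / (1 - q))⁻¹ := by
    have : y / (1 - q) - y = q * (y / (1 - q)) := by
      field_simp
      ring
    rw [this, div_eq_mul_inv, mul_inv, mul_assoc]
  calc D * (D / (y / (1 - q) - y)) ^ m * (y / (1 - q)) ^ (m + d)
      = D ^ (m + 1) * (y / (1 - q)) ^ d * q⁻¹ ^ m := by
        have : y / (1 - q) ≠ 0 := by positivity
        rw [hA, mul_pow, mul_pow, inv_pow (y / (1 - q)), pow_add (y / (1 - q))]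
        field_simp
        ring
    -- From `m < M * q` come both `d ≥ M * (1 - q)` and `q⁻¹ ^ m ≤ q ^ (-q * M)`.
    _ ≤ D ^ (m + d) * x ^ (((m + d : ℕ) : ℝ) * (1 - q)) * (q ^ (-q)) ^ (m + d) := by
        gcongr ?_ * ?_ * ?_
        · exact pow_le_pow_right₀ hD (by omega)
        · calc (y / (1 - q)) ^ d ≤ x ^ d := by gcongr
            _ = x ^ (d : ℝ) := (Real.rpow_natCast _ _).symm
            _ ≤ _ := by
              apply Real.rpow_le_rpow_of_exponent_ge hx0 (by linarith)
              push_cast at hm ⊢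
              nlinarith
        · rw [← Real.rpow_natCast, ← Real.rpow_natCast, ← Real.rpow_mul hq0.le, ← Real.rpow_neg_one,
            ← Real.rpow_mul hq0.le]
          apply Real.rpow_le_rpow_of_exponent_ge hq0 hq1.le
          linarith
    _ ≤ D ^ (m + d) * x ^ (((m + d : ℕ) : ℝ) * (1 - q)) * (2 ^ entropy q) ^ (m + d) := by
        gcongr
        rw [two_rpow_entropy hq0 hq1]
        refine le_mul_of_one_le_right (by positivity) ?_
        exact Real.one_le_rpow_of_pos_of_le_one_of_nonpos hq (by linarith) (by linarith)
    _ = _ := by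
        have hDlog : D = 2 ^ Real.logb 2 D := (Real.rpow_logb two_pos (by norm_num) hD0).symm
        nth_rewrite 1 [hDlog]
        rw [hx, ← Real.rpow_natCast, ← Real.rpow_natCast, ← Real.rpow_mul two_pos.le,
          ← Real.rpow_mul two_pos.le, ← Real.rpow_mul two_pos.le, ← Real.rpow_add two_pos,
          ← Real.rpow_add two_pos]
        congr 1
        ring

/-! ### The probability of a stall -/

theorem measurableSet_setOf_finite {Ω α : Type*} [MeasurableSpace Ω] [Finite α]
    {X : α → Ω → Bool} (hX : ∀ a, Measurable (X a)) (P : (α → Bool) → Prop) :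
    MeasurableSet {ω | P fun a => X a ω} :=
  (measurable_pi_iff.2 hX) (Set.toFinite {f | P f}).measurableSet

/-- The event is a function of finitely many bits, however many streams the definition ranges over.
-/
theorem CausalCode.measurableSet_errorSpan {n k : ℕ} {Λ Ω : Type*} (C : CausalCode n k Λ)
    [MeasurableSpace Ω] {Y : ℕ → Fin n → Ω → Bool} {r t : ℕ}
    (hY : ∀ s ∈ Finset.Ioc r t, ∀ q, Measurable (Y s q)) :
    MeasurableSet {ω | C.ErrorSpan (fun s q => Y s q ω) r t} := by
  convert measurableSet_setOf_finite (X := fun (a : Finset.Ioc r t × Fin n) => Y a.1 a.2)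
    (fun a => hY a.1 a.1.2 a.2)
    (fun f => C.ErrorSpan (fun s q => if h : s ∈ Finset.Ioc r t then f (⟨s, h⟩, q) else false) r t)
    using 3
  exact C.errorSpan_congr fun s hs => by simp only [dif_pos hs]

/-- A span makes decoding of block `r + 1` fail even for the zero stream, and `t - (r + 1) + 1 = t -
r`. -/
theorem CausalCode.IsAnytimeReliable.measureReal_errorSpan_le {n k : ℕ} {Λ Ω : Type*}
    {C : CausalCode n k Λ} {p : I} {R β : ℝ} (hC : C.IsAnytimeReliable p R β)
    [MeasurableSpace Ω] {μ : Measure Ω} {Y : ℕ → Fin n → Ω → Bool}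
    (hY : ∀ s q, Measurable (Y s q))
    (hlaw : μ.map (fun ω (a : ℕ × Fin n) => Y a.1 a.2 ω) = erasureLaw n p) {r t : ℕ} (hrt : r < t) :
    μ.real {ω | C.ErrorSpan (fun s q => Y s q ω) r t} ≤ ((2 : ℝ) ^ (-β)) ^ (t - r) := by
  have : IsProbabilityMeasure (erasureLaw n p) := by unfold erasureLaw; infer_instance
  have hm : MeasurableSet {e : ℕ × Fin n → Bool | C.ErrorSpan (fun s q => e (s, q)) r t} :=
    C.measurableSet_errorSpan fun s _ q => measurable_pi_apply (s, q)
  have hmap := map_measureReal_apply (μ := μ)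
    (measurable_pi_iff.2 fun a => hY a.1 a.2 : Measurable fun ω (a : ℕ × Fin n) => Y a.1 a.2 ω) hm
  rw [hlaw] at hmap
  calc μ.real {ω | C.ErrorSpan (fun s q => Y s q ω) r t}
      = (erasureLaw n p).real {e | C.ErrorSpan (fun s q => e (s, q)) r t} := hmap.symm
    _ ≤ _ := measureReal_mono fun e he => C.decode_ne_of_errorSpan (fun _ => 0) he
    _ ≤ _ := hC.2 (fun _ => 0) (r + 1) t (by omega) (by omega)
    _ = _ := by
        rw [← Real.rpow_natCast, ← Real.rpow_mul two_pos.le, Nat.cast_sub hrt.le]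
        congr 1
        push_cast
        ring

section Network

variable {ι Ω : Type*} {G : SimpleGraph ι} {n : ℕ}

/-- The events that are determined by the erasures in the rounds of `T`. -/
abbrev roundAlgebra (G : SimpleGraph ι) (X : ι → ι → ℕ → Fin n → Ω → Bool) (T : Set ℕ) :
    MeasurableSpace Ω :=
  ⨆ a ∈ {a : {l : ι × ι // G.Adj l.1 l.2} × ℕ × Fin n | a.2.1 ∈ T},
    MeasurableSpace.comap (X a.1.1.1 a.1.1.2 a.2.1 a.2.2) inferInstance

theorem roundAlgebra_mono (X : ι → ι → ℕ → Fin n → Ω → Bool) {T T' : Set ℕ} (h : T ⊆ T') :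
    roundAlgebra G X T ≤ roundAlgebra G X T' :=
  biSup_mono fun _ ha => h ha

theorem measurable_roundAlgebra (X : ι → ι → ℕ → Fin n → Ω → Bool) {T : Set ℕ} {i j : ι}
    (hij : G.Adj i j) {s : ℕ} (hs : s ∈ T) (q : Fin n) :
    Measurable[roundAlgebra G X T] (X i j s q) := by
  rw [measurable_iff_comap_le]
  exact le_biSup (fun a : {l : ι × ι // G.Adj l.1 l.2} × ℕ × Fin n =>
    MeasurableSpace.comap (X a.1.1.1 a.1.1.2 a.2.1 a.2.2) inferInstance)
    (i := (⟨(i, j), hij⟩, s, q)) hs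

variable {Λ : Type*} {k : ℕ} (S : Protocol ι n k Λ)

theorem measurableSet_errorSpan_roundAlgebra (X : ι → ι → ℕ → Fin n → Ω → Bool) {i j : ι}
    (hij : G.Adj j i) (r t : ℕ) :
    MeasurableSet[roundAlgebra G X (Set.Ioc r t)]
      {ω | (S.code i).ErrorSpan (fun s q => X j i s q ω) r t} := by
  let _ := roundAlgebra G X (Set.Ioc r t)
  exact (S.code i).measurableSet_errorSpan fun s hs q =>
    measurable_roundAlgebra X hij (Finset.mem_Ioc.1 hs) q

/-- Stalls are adapted to the past, which makes them independent of spans over later rounds. -/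
theorem measurableSet_stall [Finite ι] (X : ι → ι → ℕ → Fin n → Ω → Bool) (ℓ : ℕ) (j : ι) (t : ℕ) :
    MeasurableSet[roundAlgebra G X (Set.Iic t)]
      {ω | Stall G S (fun i j s q => X i j s q ω) ℓ j t} := by
  induction ℓ generalizing j t with
  | zero => exact MeasurableSet.const _
  | succ ℓ ih =>
    rcases t with _ | t
    · simp only [stall_zero_right]
      exact MeasurableSet.const _
    simp only [stall_succ_succ, Set.ofPred_or, Set.ofPred_exists]
    let _ := roundAlgebra G X (Set.Iic (t + 1))
    have hle : ∀ r ≤ t, roundAlgebra G X (Set.Iic r) ≤ roundAlgebra G X (Set.Iic (t + 1)) :=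
      fun r hr => roundAlgebra_mono X (Set.Iic_subset_Iic.2 (by omega))
    refine MeasurableSet.union ?_ ?_
    · refine MeasurableSet.iUnion fun i => ?_
      exact MeasurableSet.inter (MeasurableSet.const _) (hle t le_rfl _ (ih i t))
    · refine MeasurableSet.iUnion fun i => ?_
      by_cases hij : G.Adj j i
      · simp only [hij, true_and, Set.ofPred_exists]
        refine MeasurableSet.iUnion fun r => ?_
        by_cases hr : r < t
        · simp only [hr, true_and]
          refine MeasurableSet.inter ?_ (hle r hr.le _ (ih i r))
          exact roundAlgebra_mono X (fun s hs => by simp only [Set.mem_Ioc, Set.mem_Iic] at *; omega)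
            _ (measurableSet_errorSpan_roundAlgebra S X hij r t)
        · simp [hr]
      · simp [hij]

variable [MeasurableSpace Ω] {p : I} {μ : Measure Ω} {X : ι → ι → ℕ → Fin n → Ω → Bool}

theorem IsAsymmetricErasure.indep_roundAlgebra (hX : IsAsymmetricErasure G p μ X) {T T' : Set ℕ}
    (h : Disjoint T T') : Indep (roundAlgebra G X T) (roundAlgebra G X T') μ :=
  indep_iSup_of_disjoint (fun a => (hX.measurable _ _ _ _ a.1.2).comap_le) hX.indep.iIndep
    (Set.disjoint_left.2 fun _ ha ha' => Set.disjoint_left.1 h ha ha')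

theorem IsAsymmetricErasure.map_link [IsProbabilityMeasure μ] (hX : IsAsymmetricErasure G p μ X)
    {i j : ι} (hij : G.Adj i j) :
    μ.map (fun ω (a : ℕ × Fin n) => X i j a.1 a.2 ω) = erasureLaw n p := by
  have hi : iIndepFun (fun a : ℕ × Fin n => X i j a.1 a.2) μ :=
    hX.indep.precomp (g := fun a : ℕ × Fin n => (⟨(i, j), hij⟩, a)) fun _ _ h =>
      (Prod.ext_iff.1 h).2
  rw [(iIndepFun_iff_map_fun_eq_infinitePi_map
    (X := fun (a : ℕ × Fin n) => X i j a.1 a.2) fun a => hX.measurable i j a.1 a.2 hij).1 hi]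
  simp only [hX.law i j _ _ hij, erasureLaw]

variable [Fintype ι]

theorem measureReal_errorSpan_inter_stall_le [IsProbabilityMeasure μ]
    (hX : IsAsymmetricErasure G p μ X) {R β : ℝ} {i j : ι}
    (hcode : (S.code i).IsAnytimeReliable p R β) (hij : G.Adj j i) {r t : ℕ} (hrt : r < t) (ℓ : ℕ) :
    μ.real {ω | (S.code i).ErrorSpan (fun s q => X j i s q ω) r t ∧
        Stall G S (fun i j s q => X i j s q ω) ℓ i r} ≤
      ((2 : ℝ) ^ (-β)) ^ (t - r) * μ.real {ω | Stall G S (fun i j s q => X i j s q ω) ℓ i r} := by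
  have hind := hX.indep_roundAlgebra (T := Set.Ioc r t) (T' := Set.Iic r)
    (Set.disjoint_left.2 fun s hs hs' => not_lt_of_ge hs' hs.1)
  have := (Indep_iff _ _ μ).1 hind _ _ (measurableSet_errorSpan_roundAlgebra S X hij r t)
    (measurableSet_stall S X ℓ i r)
  rw [Set.ofPred_and, measureReal_def, this, ENNReal.toReal_mul]
  exact mul_le_mul_of_nonneg_right (hcode.measureReal_errorSpan_le
    (fun s q => hX.measurable _ _ _ _ hij) (hX.map_link hij) hrt) ENNReal.toReal_nonneg

/-- Union bound over the last step of the chain. The term `r = t` is a step without a span, and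
`maxDegree + 1` counts the node itself and its neighbours. -/
theorem measureReal_stall_succ_le [IsProbabilityMeasure μ] [DecidableEq ι] [DecidableRel G.Adj]
    (hX : IsAsymmetricErasure G p μ X) {R β : ℝ}
    (hcode : ∀ i, (S.code i).IsAnytimeReliable p R β) {ℓ : ℕ} {f : ℕ → ℝ}
    (hf : ∀ i r, μ.real {ω | Stall G S (fun i j s q => X i j s q ω) ℓ i r} ≤ f r) (j : ι) (t : ℕ) :
    μ.real {ω | Stall G S (fun i j s q => X i j s q ω) (ℓ + 1) j (t + 1)} ≤
      (G.maxDegree + 1) * ∑ r ∈ Finset.range (t + 1), ((2 : ℝ) ^ (-β)) ^ (t - r) * f r := by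
  set y : ℝ := 2 ^ (-β) with hy
  have hy0 : 0 < y := by positivity
  have hf0 : ∀ r, 0 ≤ f r := fun r => measureReal_nonneg.trans (hf j r)
  have hsub : {ω | Stall G S (fun i j s q => X i j s q ω) (ℓ + 1) j (t + 1)} ⊆
      (⋃ i ∈ insert j (G.neighborFinset j), {ω | Stall G S (fun i j s q => X i j s q ω) ℓ i t}) ∪
      ⋃ i ∈ G.neighborFinset j, ⋃ r ∈ Finset.range t,
        {ω | (S.code i).ErrorSpan (fun s q => X j i s q ω) r t ∧
          Stall G S (fun i j s q => X i j s q ω) ℓ i r} := by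
    intro ω hω
    rw [Set.mem_ofPred_eq, stall_succ_succ] at hω
    rcases hω with ⟨i, hi, h⟩ | ⟨i, hi, r, hr, h⟩
    · left
      simp only [Set.mem_iUnion, Finset.mem_insert, SimpleGraph.mem_neighborFinset]
      exact ⟨i, hi, h⟩
    · right
      simp only [Set.mem_iUnion, SimpleGraph.mem_neighborFinset, Finset.mem_range]
      exact ⟨i, hi, r, hr, h⟩
  have hdeg : ((G.neighborFinset j).card : ℝ) ≤ G.maxDegree := by
    exact_mod_cast G.degree_le_maxDegree j
  calc _ ≤ _ := measureReal_mono hsub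
    _ ≤ _ := measureReal_union_le _ _
    _ ≤ ∑ i ∈ insert j (G.neighborFinset j), f t +
        ∑ i ∈ G.neighborFinset j, ∑ r ∈ Finset.range t, y ^ (t - r) * f r := by
      refine add_le_add ((measureReal_biUnion_finset_le _ _).trans
        (Finset.sum_le_sum fun i _ => hf i t)) ((measureReal_biUnion_finset_le _ _).trans
        (Finset.sum_le_sum fun i hi => (measureReal_biUnion_finset_le _ _).trans
        (Finset.sum_le_sum fun r hr => ?_)))
      refine (measureReal_errorSpan_inter_stall_le S hX (hcode i) (by simpa using hi)
        (Finset.mem_range.1 hr) ℓ).trans ?_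
      gcongr
      exact hf i r
    _ ≤ (G.maxDegree + 1) * f t +
        (G.maxDegree + 1) * ∑ r ∈ Finset.range t, y ^ (t - r) * f r := by
      rw [Finset.sum_const, Finset.sum_const, nsmul_eq_mul, nsmul_eq_mul,
        Finset.card_insert_of_notMem (by simp)]
      have hs : 0 ≤ ∑ r ∈ Finset.range t, y ^ (t - r) * f r :=
        Finset.sum_nonneg fun r _ => mul_nonneg (by positivity) (hf0 r)
      push_cast
      have := hf0 t
      gcongr
      linarith
    _ = _ := by
      rw [Finset.sum_range_succ, Nat.sub_self, pow_zero, one_mul]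
      ring

theorem measureReal_stall_le [IsProbabilityMeasure μ] [DecidableEq ι] [DecidableRel G.Adj]
    (hX : IsAsymmetricErasure G p μ X) {R β : ℝ}
    (hcode : ∀ i, (S.code i).IsAnytimeReliable p R β) {w A : ℝ} (hA : 1 ≤ A)
    (hw : (2 : ℝ) ^ (-β) ≤ w) (hAD : A * (w - 2 ^ (-β)) = G.maxDegree + 1) (ℓ : ℕ) (j : ι) (t : ℕ) :
    μ.real {ω | Stall G S (fun i j s q => X i j s q ω) (ℓ + 1) j (t + 1)} ≤
      (G.maxDegree + 1) * A ^ ℓ * w ^ t := by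
  have hy0 : (0 : ℝ) < 2 ^ (-β) := by positivity
  induction ℓ generalizing j t with
  | zero =>
    refine (measureReal_stall_succ_le S hX hcode (f := fun r => if r = 0 then 1 else 0) ?_ j t).trans
      ?_
    · intro i r
      rcases r with _ | r
      · simp [Stall]
      · simp [Stall]
    · simp only [mul_ite, mul_one, mul_zero, Finset.sum_ite_eq', Finset.mem_range, pow_zero,
        Nat.succ_pos, if_true, Nat.sub_zero]
      gcongr
  | succ ℓ ih =>
    refine (measureReal_stall_succ_le S hX hcode
      -- At time 0 a stall is certain, so only the trivial bound 1 is available there.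
      (f := fun r => if r = 0 then 1 else (G.maxDegree + 1) * A ^ ℓ * w ^ (r - 1)) ?_ j t).trans ?_
    · intro i r
      rcases r with _ | r
      · simp [stall_zero_right]
      · simpa using ih i r
    · rw [mul_assoc]
      refine mul_le_mul_of_nonneg_left ?_ (by positivity)
      exact sum_pow_mul_le hy0.le hA hAD (by simp) (fun t => by simp) t

theorem failure_le [IsProbabilityMeasure μ] [DecidableEq ι] [DecidableRel G.Adj]
    (hX : IsAsymmetricErasure G p μ X) {R β : ℝ}
    (hcode : ∀ i, (S.code i).IsAnytimeReliable p R β) {w : ℝ} (hw1 : w ≤ 1)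
    (hw : (2 : ℝ) ^ (-β) < w) (M m : ℕ) :
    μ.real {ω | ¬ Completes G S (fun i j s q => X i j s q ω) M (m + 1)} ≤ Fintype.card ι *
      ((G.maxDegree + 1) * ((G.maxDegree + 1) / (w - 2 ^ (-β))) ^ m * w ^ M) := by
  have hy0 : (0 : ℝ) < 2 ^ (-β) := by positivity
  have hwy : 0 < w - (2 : ℝ) ^ (-β) := sub_pos.2 hw
  calc _ ≤ μ.real (⋃ i ∈ Finset.univ,
        {ω | Stall G S (fun i j s q => X i j s q ω) (m + 1) i (M + 1)}) := by
        refine measureReal_mono (fun ω hω => ?_) (measure_ne_top _ _)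
        simpa using! exists_stall_of_not_completes G S _ hω
    _ ≤ _ := measureReal_biUnion_finset_le _ _
    _ ≤ ∑ i : ι, ((G.maxDegree + 1) * ((G.maxDegree + 1) / (w - 2 ^ (-β))) ^ m * w ^ M) := by
      refine Finset.sum_le_sum fun i _ => measureReal_stall_le S hX hcode ?_ hw.le ?_ m i M
      -- `A ≥ 1` because `w - y ≤ 1 ≤ maxDegree + 1`.
      · rw [one_le_div hwy]
        linarith [(Nat.cast_nonneg G.maxDegree : (0 : ℝ) ≤ G.maxDegree)]
      · exact div_mul_cancel₀ _ hwy.ne'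
    _ = _ := by simp

end Network

/-! ### Convergence of the averaging without erasures -/

section Averaging

variable {ι : Type*} [Fintype ι] [DecidableEq ι] (G : SimpleGraph ι) [DecidableRel G.Adj]

theorem noiseless_succ_eq (ε : ℝ) (x₀ : ι → ℝ) (ℓ : ℕ) :
    noiseless G ε x₀ (ℓ + 1) =
      noiseless G ε x₀ ℓ - ε • (G.lapMatrix ℝ).mulVec (noiseless G ε x₀ ℓ) := by
  funext i
  simp [noiseless, SimpleGraph.lapMatrix_mulVec_apply, Finset.sum_sub_distrib]

theorem sum_lapMatrix_mulVec (x : ι → ℝ) : ∑ i, (G.lapMatrix ℝ).mulVec x i = 0 := by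
  have h : ∑ i, (G.lapMatrix ℝ).mulVec x i = (fun _ => (1 : ℝ)) ⬝ᵥ (G.lapMatrix ℝ).mulVec x := by
    simp [dotProduct]
  rw [h, Matrix.dotProduct_mulVec, ← Matrix.mulVec_transpose, (G.isSymm_lapMatrix (R := ℝ)).eq,
    G.lapMatrix_mulVec_const_eq_zero, zero_dotProduct]

theorem sum_noiseless (ε : ℝ) (x₀ : ι → ℝ) (ℓ : ℕ) : ∑ i, noiseless G ε x₀ ℓ i = ∑ i, x₀ i := by
  induction ℓ with
  | zero => rfl
  | succ ℓ ih =>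
    rw [noiseless_succ_eq]
    simp [Finset.sum_sub_distrib, ← Finset.mul_sum, sum_lapMatrix_mulVec, ih]

theorem eigenvalues_bounds {ε : ℝ}
    (hev : ∀ ev : ℝ, Module.End.HasEigenvalue (Matrix.toLin' (G.lapMatrix ℝ)) ev → ε * ev < 2)
    (a : ι) : 0 ≤ (G.isHermitian_lapMatrix (R := ℝ)).eigenvalues a ∧
      ε * (G.isHermitian_lapMatrix (R := ℝ)).eigenvalues a < 2 := by
  refine ⟨(G.posSemidef_lapMatrix ℝ).eigenvalues_nonneg a, hev _ ?_⟩
  rw [Module.End.hasEigenvalue_iff_mem_spectrum, Matrix.spectrum_toLin']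
  exact Matrix.IsHermitian.eigenvalues_mem_spectrum_real _ a

/-- In an eigenbasis of the Laplacian each coordinate is multiplied by `1 - ε * λ`, of modulus below
1 unless `λ = 0`. The limit lies in the kernel, hence is constant by connectedness, and conservation
of the sum identifies the constant. -/
theorem tendsto_noiseless (hG : G.Connected) {ε : ℝ} (hε : 0 < ε)
    (hev : ∀ ev : ℝ, Module.End.HasEigenvalue (Matrix.toLin' (G.lapMatrix ℝ)) ev → ε * ev < 2)
    (x₀ : ι → ℝ) (i : ι) :
    Tendsto (fun ℓ => noiseless G ε x₀ ℓ i) atTop (𝓝 ((∑ j, x₀ j) / Fintype.card ι)) := by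
  set hA := G.isHermitian_lapMatrix (R := ℝ)
  set lam := hA.eigenvalues with hlam
  set v : ι → ι → ℝ := fun a => hA.eigenvectorBasis a with hv
  have hLv : ∀ a, (G.lapMatrix ℝ).mulVec (v a) = lam a • v a := fun a =>
    hA.mulVec_eigenvectorBasis a
  set c : ι → ℝ := fun a => hA.eigenvectorBasis.repr (WithLp.toLp 2 x₀) a with hc
  have hx₀ : x₀ = ∑ a, c a • v a := by
    have := congrArg WithLp.ofLp (hA.eigenvectorBasis.sum_repr (WithLp.toLp 2 x₀))
    simpa [hc, hv] using this.symm
  have hform : ∀ ℓ, noiseless G ε x₀ ℓ = ∑ a, (c a * (1 - ε * lam a) ^ ℓ) • v a := by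
    intro ℓ
    induction ℓ with
    | zero => simpa [noiseless] using hx₀
    | succ ℓ ih =>
      rw [noiseless_succ_eq, ih, Matrix.mulVec_sum, Finset.smul_sum, ← Finset.sum_sub_distrib]
      refine Finset.sum_congr rfl fun a _ => ?_
      rw [Matrix.mulVec_smul, hLv, smul_smul, smul_smul, ← sub_smul]
      congr 1
      ring
  set y : ι → ℝ := ∑ a, (c a * if lam a = 0 then 1 else 0) • v a with hy
  have hlim : Tendsto (noiseless G ε x₀) atTop (𝓝 y) := by
    rw [show noiseless G ε x₀ = fun ℓ => ∑ a, (c a * (1 - ε * lam a) ^ ℓ) • v a from funext hform]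
    refine tendsto_finsetSum _ fun a _ => Tendsto.smul_const (Tendsto.const_mul _ ?_) _
    split_ifs with h
    · refine tendsto_const_nhds.congr fun ℓ => ?_
      simp [h]
    · obtain ⟨h0, h2⟩ := eigenvalues_bounds G hev a
      have h0 : 0 < ε * lam a := mul_pos hε (lt_of_le_of_ne h0 (Ne.symm h))
      refine tendsto_pow_atTop_nhds_zero_of_abs_lt_one (abs_lt.2 ⟨?_, by linarith⟩)
      have : ε * lam a < 2 := h2
      linarith
  have hLy : (G.lapMatrix ℝ).mulVec y = 0 := by
    rw [hy, Matrix.mulVec_sum]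
    refine Finset.sum_eq_zero fun a _ => ?_
    rw [Matrix.mulVec_smul, hLv]
    split_ifs with h <;> simp [h]
  have hconst : ∀ j, y j = y i := fun j =>
    (G.lapMatrix_mulVec_eq_zero_iff_forall_reachable.1 hLy) j i (hG.preconnected j i)
  have hsum : ∑ j, y j = ∑ j, x₀ j := by
    refine tendsto_nhds_unique (tendsto_finsetSum Finset.univ fun j _ =>
      (tendsto_pi_nhds.1 hlim) j) ?_
    simp only [sum_noiseless]
    exact tendsto_const_nhds
  have : Nonempty ι := ⟨i⟩
  have hyi : y i = (∑ j, x₀ j) / Fintype.card ι := by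
    rw [← hsum, Finset.sum_congr rfl fun j _ => hconst j]
    simp
  rw [← hyi]
  exact (tendsto_pi_nhds.1 hlim) i

end Averaging

/-! ### The protocol -/

section Main

variable {ι Ω Λ : Type*} [Fintype ι] {G : SimpleGraph ι} [DecidableRel G.Adj] {n k : ℕ}

theorem logb_maxDegree_nonneg : 0 ≤ Real.logb 2 ((G.maxDegree : ℝ) + 1) :=
  Real.logb_nonneg one_lt_two (by linarith [(Nat.cast_nonneg G.maxDegree : (0 : ℝ) ≤ G.maxDegree)])

open Classical in
theorem exists_index_currentValue (S : Protocol ι n k Λ) (e : ι → ι → ℕ → Fin n → Bool) (i : ι)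
    (t : ℕ) : ∃ g : ℕ, currentValue G S e i t = noiseless G S.ε S.x₀ g i ∧
      ∀ m ≤ t, (computed G S e i t m).isSome → m ≤ g := by
  refine ⟨Nat.findGreatest (fun ℓ => (computed G S e i t ℓ).isSome) t, ?_,
    fun m hm h => Nat.le_findGreatest hm h⟩
  have h := Nat.findGreatest_spec (P := fun ℓ => (computed G S e i t ℓ).isSome = true)
    (Nat.zero_le t) (by simp [computed_zero])
  obtain ⟨x, hx⟩ := Option.isSome_iff_exists.1 h
  rw [currentValue, hx, Option.getD_some]
  exact computed_eq_noiseless G S e hx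

theorem tendsto_currentValue [DecidableEq ι] (hG : G.Connected) (S : Protocol ι n k Λ) (hε : 0 < S.ε)
    (hev : ∀ ev : ℝ, Module.End.HasEigenvalue (Matrix.toLin' (G.lapMatrix ℝ)) ev → S.ε * ev < 2)
    (e : ι → ι → ℕ → Fin n → Bool) (he : ∀ m, ∀ᶠ M in atTop, Completes G S e M (m + 1)) (i : ι) :
    Tendsto (currentValue G S e i) atTop (𝓝 ((∑ j, S.x₀ j) / Fintype.card ι)) := by
  choose g hg hle using exists_index_currentValue (G := G) S e i
  rw [show currentValue G S e i = (fun ℓ => noiseless G S.ε S.x₀ ℓ i) ∘ g from funext hg]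
  refine (tendsto_noiseless G hG hε hev S.x₀ i).comp (tendsto_atTop.2 fun m => ?_)
  -- The search for the latest iterate stops at index `t`, so `m ≤ t` is needed as well.
  filter_upwards [he m, eventually_ge_atTop m] with t ht hmt
  exact hle t m hmt (by rw [ht i m (by omega)]; rfl)

variable [MeasurableSpace Ω] {p : I} {μ : Measure Ω} [IsProbabilityMeasure μ]
  {X : ι → ι → ℕ → Fin n → Ω → Bool}

/-- With the number of iterations fixed, failure decays like `w ^ M` for any `w` in `(2 ^ (-β), 1)`,
so Borel–Cantelli applies as soon as `β > 0`. -/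
theorem ae_eventually_completes [DecidableEq ι] (S : Protocol ι n k Λ)
    (hX : IsAsymmetricErasure G p μ X) {R β : ℝ}
    (hcode : ∀ i, (S.code i).IsAnytimeReliable p R β) (hβ : 0 < β) :
    ∀ᵐ ω ∂μ, ∀ m, ∀ᶠ M in atTop, Completes G S (fun i j s q => X i j s q ω) M (m + 1) := by
  rw [ae_all_iff]
  intro m
  have hy0 : (0 : ℝ) < 2 ^ (-β) := by positivity
  have hy1 : (2 : ℝ) ^ (-β) < 1 := Real.rpow_lt_one_of_one_lt_of_neg one_lt_two (by linarith)
  obtain ⟨w, hw, hw1⟩ := exists_between hy1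
  have hsum : Summable fun M => μ.real
      {ω | ¬ Completes G S (fun i j s q => X i j s q ω) M (m + 1)} :=
    Summable.of_nonneg_of_le (fun _ => measureReal_nonneg)
      (fun M => failure_le S hX hcode hw1.le hw M m)
      (((summable_geometric_of_lt_one (hy0.trans hw).le hw1).mul_left _).mul_left _)
  have htop := hsum.tsum_ofReal_ne_top
  simp only [measureReal_def, ENNReal.ofReal_toReal (measure_ne_top μ _)] at htop
  filter_upwards [ae_eventually_notMem htop] with ω hω
  filter_upwards [hω] with M hM
  exact not_not.1 hM

theorem failureProb_le [DecidableEq ι] (S : Protocol ι n k Λ) (hX : IsAsymmetricErasure G p μ X)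
    {R β : ℝ} (hcode : ∀ i, (S.code i).IsAnytimeReliable p R β) {q : ℝ} (hq0 : 0 ≤ q) (hq1 : q ≤ 1)
    (M : ℕ) : failureProb G S μ X M q ≤ (Fintype.card ι : ℝ) *
      (2 : ℝ) ^ (-(M : ℝ) * ((1 - q) * (β / 2) - entropy q
        - Real.logb 2 ((G.maxDegree : ℝ) + 1))) := by
  -- In the first case the power of 2 is at least 1, so the bound is trivial for a nonempty network.
  rcases le_or_gt ((1 - q) * (β / 2)) (entropy q + Real.logb 2 ((G.maxDegree : ℝ) + 1)) with h | h
  · rcases isEmpty_or_nonempty ι with hι | hι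
    · have : ∀ ω, Completes G S (fun i j s q => X i j s q ω) M ⌈(M : ℝ) * q⌉₊ :=
        fun ω i => hι.elim i
      simp [failureProb, this]
    · calc failureProb G S μ X M q ≤ 1 * 1 := by simpa using! measureReal_le_one
        _ ≤ _ := by
          gcongr
          · exact_mod_cast Fintype.card_pos
          · exact Real.one_le_rpow one_le_two
              (mul_nonneg_of_nonpos_of_nonpos (by simp) (by linarith))
  rcases h0 : ⌈(M : ℝ) * q⌉₊ with _ | m
  · rw [failureProb, h0]
    simp only [completes_zero, not_true_eq_false, Set.ofPred_false, measureReal_empty]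
    positivity
  have hMq : 0 < (M : ℝ) * q := Nat.ceil_pos.1 (by omega)
  have hceil := Nat.ceil_lt_add_one hMq.le
  rw [h0] at hceil
  have hq0' : 0 < q := hq0.lt_of_ne fun h => by simp [← h] at hMq
  -- At `q = 1` the left side of `h` would be 0, below a sum of nonnegative terms.
  have hq1' : q < 1 := hq1.lt_of_ne fun h1 => by
    have := entropy_nonneg hq0 hq1
    have := logb_maxDegree_nonneg (G := G)
    subst h1
    linarith
  obtain ⟨hw, hw1, hbound⟩ := chernoff_estimate hq0' hq1' (D := (G.maxDegree : ℝ) + 1)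
    (by linarith [(Nat.cast_nonneg G.maxDegree : (0 : ℝ) ≤ G.maxDegree)]) rfl h
  rw [failureProb, h0]
  exact (failure_le S hX hcode hw1 hw M m).trans
    (mul_le_mul_of_nonneg_left (hbound M m hceil) (Nat.cast_nonneg _))

end Main

end ErasureConsensus

theorem mainTheorem1 {ι Λ Ω : Type*} [Fintype ι] [DecidableEq ι] [MeasurableSpace Ω]
    (μ : Measure Ω) [IsProbabilityMeasure μ]
    -- the network
    (G : SimpleGraph ι) [DecidableRel G.Adj]
    -- the protocol, with an anytime reliable code at each node
    (n k : ℕ) (hn : 0 < n) (hk : 0 < k) (S : ErasureConsensus.Protocol ι n k Λ)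
    (p : unitInterval) (R β : ℝ) (hcode : ∀ i, (S.code i).IsAnytimeReliable p R β)
    -- asymmetric erasures
    (X : ι → ι → ℕ → Fin n → Ω → Bool) (hX : ErasureConsensus.IsAsymmetricErasure G p μ X)
    (R' : ℝ) (hR'0 : 0 ≤ R') (hR'1 : R' ≤ 1) :
    -- the bound on the failure probability
    (∀ M : ℕ, ErasureConsensus.failureProb G S μ X M R' ≤
      (Fintype.card ι : ℝ) *
        (2 : ℝ) ^ (-(M : ℝ) * ((1 - R') * (β / 2) - ErasureConsensus.entropy R'
          - Real.logb 2 ((G.maxDegree : ℝ) + 1)))) ∧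
    -- the iterates that the nodes compute are always those of the averaging without erasures
    (∀ (ω : Ω) (i : ι) (t ℓ : ℕ) (x : ℝ),
      ErasureConsensus.computed G S (fun i j t q => X i j t q ω) i t ℓ = some x →
        x = ErasureConsensus.noiseless G S.ε S.x₀ ℓ i) ∧
    ((1 - R') * (β / 2) > ErasureConsensus.entropy R' + Real.logb 2 ((G.maxDegree : ℝ) + 1) →
      -- exponential decay
      (∃ c > 0, ∃ K, ∀ M : ℕ, ErasureConsensus.failureProb G S μ X M R' ≤
        K * (2 : ℝ) ^ (-c * (M : ℝ))) ∧
      -- average consensus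
      (G.Connected → 0 < S.ε →
        (∀ ev : ℝ, Module.End.HasEigenvalue (Matrix.toLin' (G.lapMatrix ℝ)) ev → S.ε * ev < 2) →
        ∀ᵐ ω ∂μ, ∀ i, Tendsto
          (fun t => ErasureConsensus.currentValue G S (fun i j t q => X i j t q ω) i t)
          atTop (𝓝 ((∑ j, S.x₀ j) / Fintype.card ι)))) := by
  refine ⟨ErasureConsensus.failureProb_le S hX hcode hR'0 hR'1,
    fun ω i t ℓ x => ErasureConsensus.computed_eq_noiseless G S _, fun hβ => ⟨?_, ?_⟩⟩
  · refine ⟨(1 - R') * (β / 2) - ErasureConsensus.entropy R' -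
      Real.logb 2 ((G.maxDegree : ℝ) + 1), by linarith, Fintype.card ι, fun M =>
      (ErasureConsensus.failureProb_le S hX hcode hR'0 hR'1 M).trans_eq ?_⟩
    rw [neg_mul, neg_mul, mul_comm (M : ℝ)]
  · intro hG hε hev
    -- The threshold is nonnegative, so exceeding it forces `β > 0`, all that consensus needs from
    -- it.
    have hβ0 : 0 < β := by
      have h1 := ErasureConsensus.entropy_nonneg hR'0 hR'1
      have h2 := ErasureConsensus.logb_maxDegree_nonneg (G := G)
      by_contra hneg
      nlinarith
    filter_upwards [ErasureConsensus.ae_eventually_completes S hX hcode hβ0] with ω hω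
    exact ErasureConsensus.tendsto_currentValue hG S hε hev _ hω
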